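/- **Definitions.** Let $k\in\mathbb N$. A *topological $k$-graph* is a small category $\Lambda$ with range (codomain) and source (domain) maps $r,s$ and a functor $d:\Lambda\to\mathbb N^k$ such that: the object and morphism sets are second-countable locally compact Hausdorff spaces; $r$ and $s$ are continuous and $s$ is a local homeomorphism; composition $(\lambda,\mu)\mapsto\lambda\mu$ (for $s(\lambda)=r(\mu)$) is continuous and open; $d$ is continuous for the discrete topology on $\mathbb N^k$; and whenever $d(\lambda)=m+n$ there is a unique composable pair $(\xi,\eta)$ with $\lambda=\xi\eta$, $d(\xi)=m$, $d(\eta)=n$. Put $\Lambda^m=d^{-1}(m)$. $\Lambda$ is *compactly aligned* if for all $p,q\in\mathbb N^k$ and compact $U\subset\Lambda^p$, $V\subset\Lambda^q$ the set $U\Lambda^{(p\vee q)-p}\cap V\Lambda^{(p\vee q)-q}$ is compact. For $m\in(\mathbb N\cup\{\infty\})^k$ let $\Omega_{k,m}$ be the (discrete) category with objects $p\in\mathbb N^k$, $p\le m$, and morphisms $(p,q)$, $p\le q\le m$, with range $p$, source $q$ and degree $q-p$. The path space $X_\Lambda$ is the set of all degree-preserving functors $x:\Omega_{k,m}\to\Lambda$,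 $m=:d(x)\in(\mathbb N\cup\{\infty\})^k$; write $r(x)=x(0)$. For $s(\lambda)=r(x)$, $\lambda x$ denotes the concatenated path. The *path groupoid* $G_\Lambda$ has unit set $X_\Lambda$ and morphisms the triples $(\lambda x,d(\lambda)-d(\mu),\mu x)\in X_\Lambda\times\mathbb Z^k\times X_\Lambda$ with $\lambda,\mu\in\Lambda$, $x\in X_\Lambda$, $s(\lambda)=s(\mu)=r(x)$; $r(x,m,y)=x$, $s(x,m,y)=y$, $(x,m,y)(y,n,z)=(x,m+n,z)$, $(x,m,y)^{-1}=(y,-m,x)$. For a set $F$ of pairs $(\lambda,\mu)$ with $s(\lambda)=s(\mu)$, let $Z(F,m)$ be the set of the triples $(\lambda x,d(\lambda)-d(\mu),\mu x)$ with $(\lambda,\mu)\in F$ and $d(\lambda)-d(\mu)=m$. The topology of $G_\Lambda$ is generated by the sets $Z(\{(\lambda,\mu)\in U\times V: s(\lambda)=s(\mu)\},m)\setminus Z(F,m)$ with $m\in\mathbb Z^k$, $U,V\subset\Lambda$ open and $F$ compact. For a vertex $v$, let $v\mathcal{CE}(\Lambda)$ be the set of compact $E\subset\Lambda$ such that $r(E)$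 is a neighbourhood of $v$ and for every $\lambda\in\Lambda$ with $r(\lambda)\in r(E)$ there are $\mu\in E$ and $\alpha,\beta\in\Lambda$ with $\lambda\alpha=\mu\beta$ and $d(\lambda\alpha)=d(\lambda)\vee d(\mu)$. The set $\partial\Lambda$ of boundary paths consists of those $x\in X_\Lambda$ such that for all $m\in\mathbb N^k$ with $m\le d(x)$ and all $E\in x(m)\mathcal{CE}(\Lambda)$ there is $\lambda\in E$ with $m+d(\lambda)\le d(x)$ and $x(m,m+d(\lambda))=\lambda$. The *boundary-path groupoid* $\mathcal G_\Lambda$ is the reduction $G_\Lambda|_{\partial\Lambda}$. Let $A$ be a locally compact (Hausdorff) group and $c:\Lambda\to A$ a continuous functor. The *skew product* $\Lambda\times_cA$ has object space $\mathrm{Obj}(\Lambda)\times A$ and morphism space $\Lambda\times A$ (product topologies), $r(\lambda,a)=(r(\lambda),a)$, $s(\lambda,a)=(s(\lambda),ac(\lambda))$, $(\lambda,a)(\mu,ac(\lambda))=(\lambda\mu,a)$ and $d(\lambda,a)=d(\lambda)$. (It is a topological $k$-graph, except that it need not be second countable when $A$ is not; $G$, $\partial$ and $\mathcal G$ are defined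 for it as above.) The functor $c$ induces a continuous functor $\tilde c:G_\Lambda\to A$, $\tilde c(\lambda x,d(\lambda)-d(\mu),\mu x)=c(\lambda)c(\mu)^{-1}$. For a groupoid $\Gamma$ with a topology and a continuous functor $b:\Gamma\to A$, the skew product $\Gamma(b)$ is $\Gamma\times A$ with the product topology, $(\gamma,g)(\gamma',g\,b(\gamma))=(\gamma\gamma',g)$ and $(\gamma,g)^{-1}=(\gamma^{-1},g\,b(\gamma))$. **Proposition.** Let $\Lambda$ be a compactly aligned topological $k$-graph, let $A$ be a locally compact group and let $c:\Lambda\to A$ be a continuous functor. Then, as topological groupoids (that is, by a groupoid isomorphism which is a homeomorphism), $$G_\Lambda(\tilde c)\cong G_{\Lambda\times_cA}.$$ Furthermore, denoting the restriction of $\tilde c$ to $\mathcal G_\Lambda=G_\Lambda|_{\partial\Lambda}$ again by $\tilde c$, $$\mathcal G_\Lambda(\tilde c)\cong\mathcal G_{\Lambda\times_cA}.$$ -/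

import Mathlib

universe u v w

namespace HRGraph

open Topology

/-! ## Small categories with a space of morphisms -/

/-- A small category given by its set of objects, its set of morphisms, range (codomain) and
source (domain) maps, identities, and the composition `f g` of those pairs `(f, g)` with
`s f = r g`.  The set of morphisms carries a topology. -/
structure ArrCat where
  Obj : Type u
  Mor : Type v
  [topMor : TopologicalSpace Mor]
  r : Mor → Obj
  s : Mor → Obj
  one : Obj → Mor
  comp : (f g : Mor) → s f = r g → Mor
  r_one : ∀ a, r (one a) = a
  s_one : ∀ a, s (one a) = a
  r_comp : ∀ f g h, r (comp f g h) = r f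
  s_comp : ∀ f g h, s (comp f g h) = s g
  one_comp : ∀ f, comp (one (r f)) f (s_one _) = f
  comp_one : ∀ f, comp f (one (s f)) (r_one _).symm = f
  assoc : ∀ (f g k : Mor) (h : s f = r g) (h' : s g = r k),
    comp (comp f g h) k ((s_comp f g h).trans h')
      = comp f (comp g k h') (h.trans (r_comp g k h').symm)

attribute [instance] ArrCat.topMor

/-- A continuous functor from a category to a topological group (viewed as a category with one
object). -/
structure ContFunctor (C : ArrCat.{u, v}) (A : Type w) [Group A] [TopologicalSpace A] where
  toFun : C.Mor → A
  map_one : ∀ a, toFun (C.one a) = 1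
  map_comp : ∀ f g h, toFun (C.comp f g h) = toFun f * toFun g
  continuous_toFun : Continuous toFun

/-- The skew product of a category by a functor `c` into a group `A`: objects `Obj × A`,
morphisms `Mor × A` (product topology), `r (f, a) = (r f, a)`, `s (f, a) = (s f, a c(f))` and
`(f, a) (g, a c(f)) = (f g, a)`. -/
def ArrCat.skew (C : ArrCat.{u, v}) {A : Type w} [Group A] [TopologicalSpace A]
    (c : ContFunctor C A) : ArrCat.{max u w, max v w} where
  Obj := C.Obj × A
  Mor := C.Mor × A
  r f := (C.r f.1, f.2)
  s f := (C.s f.1, f.2 * c.toFun f.1)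
  one a := (C.one a.1, a.2)
  comp f g h := (C.comp f.1 g.1 (congrArg Prod.fst h), f.2)
  r_one a := by simp [C.r_one]
  s_one a := by simp [C.s_one, c.map_one]
  r_comp f g h := by simp [C.r_comp]
  s_comp f g h := by
    have h2 : f.2 * c.toFun f.1 = g.2 := congrArg Prod.snd h
    simp [C.s_comp, c.map_comp, ← h2, mul_assoc]
  one_comp f := by simp [C.one_comp]
  comp_one f := by simp [C.comp_one]
  assoc f g k h h' := Prod.ext (C.assoc _ _ _ _ _) rfl

/-! ## Groupoids -/

/-- A groupoid whose set of morphisms carries a topology.  As usual, the space of objects (units)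
is topologised as the subspace of identity morphisms.  (Continuity of the operations is not needed
to say what an isomorphism of topological groupoids is.) -/
structure TopGroupoid extends ArrCat.{u, v} where
  inv : Mor → Mor
  r_inv : ∀ f, r (inv f) = s f
  s_inv : ∀ f, s (inv f) = r f
  inv_comp : ∀ f, comp (inv f) f (s_inv f) = one (s f)
  comp_inv : ∀ f, comp f (inv f) (r_inv f).symm = one (r f)

namespace TopGroupoid

instance (G : TopGroupoid.{u, v}) : TopologicalSpace G.Obj :=
  TopologicalSpace.induced G.one inferInstance

/-- An isomorphism of topological groupoids: an isomorphism of categories which is a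
homeomorphism on morphisms and on units. -/
structure Iso (G : TopGroupoid.{u, v}) (H : TopGroupoid.{u, v}) where
  obj : G.Obj ≃ₜ H.Obj
  mor : G.Mor ≃ₜ H.Mor
  map_r : ∀ f, H.r (mor f) = obj (G.r f)
  map_s : ∀ f, H.s (mor f) = obj (G.s f)
  map_one : ∀ a, mor (G.one a) = H.one (obj a)
  map_comp : ∀ (f g : G.Mor) (h : G.s f = G.r g),
    mor (G.comp f g h)
      = H.comp (mor f) (mor g) ((map_s f).trans ((congrArg obj h).trans (map_r g).symm))

/-- The skew-product groupoid `G(b)`; the inverse is `(x, g)⁻¹ = (x⁻¹, g b(x))`. -/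
def skew (G : TopGroupoid.{u, v}) {A : Type w} [Group A] [TopologicalSpace A]
    (b : ContFunctor G.toArrCat A) : TopGroupoid.{max u w, max v w} where
  toArrCat := G.toArrCat.skew b
  inv f := (G.inv f.1, f.2 * b.toFun f.1)
  r_inv f := by simp [ArrCat.skew, G.r_inv]
  s_inv f := by
    have h : b.toFun f.1 * b.toFun (G.inv f.1) = 1 := by
      rw [← b.map_comp f.1 (G.inv f.1) (G.r_inv _).symm, G.comp_inv, b.map_one]
    simp [ArrCat.skew, G.s_inv, mul_assoc, h]
  inv_comp f := by simp [ArrCat.skew, G.inv_comp]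
  comp_inv f := by simp [ArrCat.skew, G.comp_inv]

/-- The reduction `G|_Y` of a groupoid to a set `Y` of units. -/
def reduction (G : TopGroupoid.{u, v}) (Y : Set G.Obj) : TopGroupoid.{u, v} where
  Obj := Y
  Mor := {f : G.Mor // G.r f ∈ Y ∧ G.s f ∈ Y}
  r f := ⟨G.r f.1, f.2.1⟩
  s f := ⟨G.s f.1, f.2.2⟩
  one a := ⟨G.one a.1, by rw [G.r_one]; exact a.2, by rw [G.s_one]; exact a.2⟩
  comp f g h := ⟨G.comp f.1 g.1 (congrArg Subtype.val h),
    by rw [G.r_comp]; exact f.2.1, by rw [G.s_comp]; exact g.2.2⟩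
  r_one a := Subtype.ext (G.r_one _)
  s_one a := Subtype.ext (G.s_one _)
  r_comp f g h := Subtype.ext (G.r_comp _ _ _)
  s_comp f g h := Subtype.ext (G.s_comp _ _ _)
  one_comp f := Subtype.ext (G.one_comp _)
  comp_one f := Subtype.ext (G.comp_one _)
  assoc f g k h h' := Subtype.ext (G.assoc _ _ _ _ _)
  inv f := ⟨G.inv f.1, by rw [G.r_inv]; exact f.2.2, by rw [G.s_inv]; exact f.2.1⟩
  r_inv f := Subtype.ext (G.r_inv _)
  s_inv f := Subtype.ext (G.s_inv _)
  inv_comp f := Subtype.ext (G.inv_comp _)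
  comp_inv f := Subtype.ext (G.comp_inv _)

/-- The restriction of a continuous functor to a reduction. -/
def restrict {G : TopGroupoid.{u, v}} {A : Type w} [Group A] [TopologicalSpace A]
    (b : ContFunctor G.toArrCat A) (Y : Set G.Obj) :
    ContFunctor (G.reduction Y).toArrCat A where
  toFun f := b.toFun f.1
  map_one a := b.map_one _
  map_comp f g h := b.map_comp _ _ _
  continuous_toFun := b.continuous_toFun.comp continuous_subtype_val

end TopGroupoid

/-! ## Topological higher-rank graphs -/

/-- A topological `k`-graph, except that second countability of the two spaces is not part of the
structure and is imposed separately where it is wanted: all the other conditions are inherited by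
the skew product by an arbitrary locally compact group. -/
structure TopKGraph (k : ℕ) extends ArrCat.{u, v} where
  [topObj : TopologicalSpace Obj]
  [t2Obj : T2Space Obj]
  [t2Mor : T2Space Mor]
  [lcObj : LocallyCompactSpace Obj]
  [lcMor : LocallyCompactSpace Mor]
  continuous_r : Continuous r
  isLocalHomeomorph_s : IsLocalHomeomorph s
  continuous_comp :
    Continuous fun p : {p : Mor × Mor // s p.1 = r p.2} => comp p.1.1 p.1.2 p.2
  isOpenMap_comp :
    IsOpenMap fun p : {p : Mor × Mor // s p.1 = r p.2} => comp p.1.1 p.1.2 p.2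
  /-- The degree map. -/
  deg : Mor → (Fin k → ℕ)
  deg_one : ∀ a, deg (one a) = 0
  deg_comp : ∀ f g h, deg (comp f g h) = deg f + deg g
  continuous_deg : Continuous deg
  factorization : ∀ (f : Mor) (m n : Fin k → ℕ), deg f = m + n →
    ∃! p : Mor × Mor, ∃ h : s p.1 = r p.2, comp p.1 p.2 h = f ∧ deg p.1 = m ∧ deg p.2 = n

attribute [instance] TopKGraph.topObj TopKGraph.t2Obj TopKGraph.t2Mor TopKGraph.lcObj
  TopKGraph.lcMor

/-- A product of a local homeomorphism with the identity is a local homeomorphism. -/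
theorem isLocalHomeomorph_prod_id {X Y Z : Type*} [TopologicalSpace X] [TopologicalSpace Y]
    [TopologicalSpace Z] {f : X → Y} (hf : IsLocalHomeomorph f) :
    IsLocalHomeomorph (fun p : X × Z => (f p.1, p.2)) := by
  intro p
  obtain ⟨e, he, hfe⟩ := hf p.1
  exact ⟨e.prod (OpenPartialHomeomorph.refl Z), ⟨he, trivial⟩, by funext q; simp [hfe]⟩

namespace TopKGraph

variable {k : ℕ}

/-- The skew product `Λ ×_c A` of a topological `k`-graph, with degree map `d(f, a) = d(f)` and
the product topologies. -/
def skew (Λ : TopKGraph.{u, v} k) {A : Type w} [Group A] [TopologicalSpace A]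
    [IsTopologicalGroup A] [LocallyCompactSpace A] [T2Space A]
    (c : ContFunctor Λ.toArrCat A) : TopKGraph.{max u w, max v w} k where
  toArrCat := Λ.toArrCat.skew c
  topObj := (instTopologicalSpaceProd : TopologicalSpace (Λ.Obj × A))
  t2Obj := (Prod.t2Space : T2Space (Λ.Obj × A))
  t2Mor := (Prod.t2Space : T2Space (Λ.Mor × A))
  lcObj := (Prod.locallyCompactSpace Λ.Obj A : LocallyCompactSpace (Λ.Obj × A))
  lcMor := (Prod.locallyCompactSpace Λ.Mor A : LocallyCompactSpace (Λ.Mor × A))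
  continuous_r := by
    change Continuous fun f : Λ.Mor × A => (Λ.r f.1, f.2)
    have := Λ.continuous_r
    fun_prop
  isLocalHomeomorph_s := by
    change IsLocalHomeomorph fun f : Λ.Mor × A => (Λ.s f.1, f.2 * c.toFun f.1)
    have hc := c.continuous_toFun
    let e : (Λ.Mor × A) ≃ₜ (Λ.Mor × A) :=
      { toFun := fun f => (f.1, f.2 * c.toFun f.1)
        invFun := fun f => (f.1, f.2 * (c.toFun f.1)⁻¹)
        left_inv := fun f => by simp
        right_inv := fun f => by simp
        continuous_toFun := by fun_prop
        continuous_invFun := by fun_prop }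
    exact (isLocalHomeomorph_prod_id (Z := A) Λ.isLocalHomeomorph_s).comp e.isLocalHomeomorph
  continuous_comp := by
    change Continuous fun p : {p : (Λ.Mor × A) × (Λ.Mor × A) //
      (Λ.s p.1.1, p.1.2 * c.toFun p.1.1) = (Λ.r p.2.1, p.2.2)} =>
        (Λ.comp p.1.1.1 p.1.2.1 (congrArg Prod.fst p.2), p.1.1.2)
    refine Continuous.prodMk ?_ (by fun_prop)
    exact Λ.continuous_comp.comp
      (f := fun p : {p : (Λ.Mor × A) × (Λ.Mor × A) //
        (Λ.s p.1.1, p.1.2 * c.toFun p.1.1) = (Λ.r p.2.1, p.2.2)} =>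
        (⟨(p.1.1.1, p.1.2.1), congrArg Prod.fst p.2⟩ :
          {p : Λ.Mor × Λ.Mor // Λ.s p.1 = Λ.r p.2}))
      (Continuous.subtype_mk (by fun_prop) _)
  isOpenMap_comp := by
    change IsOpenMap fun p : {p : (Λ.Mor × A) × (Λ.Mor × A) //
      (Λ.s p.1.1, p.1.2 * c.toFun p.1.1) = (Λ.r p.2.1, p.2.2)} =>
        (Λ.comp p.1.1.1 p.1.2.1 (congrArg Prod.fst p.2), p.1.1.2)
    have hc := c.continuous_toFun
    let e : {p : (Λ.Mor × A) × (Λ.Mor × A) //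
        (Λ.s p.1.1, p.1.2 * c.toFun p.1.1) = (Λ.r p.2.1, p.2.2)} ≃ₜ
        {p : Λ.Mor × Λ.Mor // Λ.s p.1 = Λ.r p.2} × A :=
      { toFun := fun p => (⟨(p.1.1.1, p.1.2.1), congrArg Prod.fst p.2⟩, p.1.1.2)
        invFun := fun q => ⟨((q.1.1.1, q.2), (q.1.1.2, q.2 * c.toFun q.1.1.1)),
          by simp [q.1.2]⟩
        left_inv := fun p => by
          obtain ⟨⟨⟨f, a⟩, ⟨g, b⟩⟩, h⟩ := p
          have h2 : a * c.toFun f = b := congrArg Prod.snd h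
          subst h2
          rfl
        right_inv := fun q => rfl
        continuous_toFun := by
          refine Continuous.prodMk (Continuous.subtype_mk (by fun_prop) _) (by fun_prop)
        continuous_invFun := by
          refine Continuous.subtype_mk (by fun_prop) _ }
    exact (Λ.isOpenMap_comp.prodMap (IsOpenMap.id (X := A))).comp e.isOpenMap
  deg f := Λ.deg f.1
  deg_one a := Λ.deg_one _
  deg_comp f g h := Λ.deg_comp _ _ _
  continuous_deg := Λ.continuous_deg.comp continuous_fst
  factorization := by
    rintro ⟨f, a⟩ m n hf
    obtain ⟨⟨g, g'⟩, ⟨h, hc, hm, hn⟩, huniq⟩ := Λ.factorization f m n hf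
    refine ⟨((g, a), (g', a * c.toFun g)), ⟨Prod.ext h rfl, Prod.ext hc rfl, hm, hn⟩, ?_⟩
    rintro ⟨⟨x, b⟩, ⟨y, b'⟩⟩ ⟨hxy, hcomp, hx, hy⟩
    have h1 : Λ.s x = Λ.r y := congrArg Prod.fst hxy
    have h2 : b * c.toFun x = b' := congrArg Prod.snd hxy
    have h3 : Λ.comp x y h1 = f := congrArg Prod.fst hcomp
    have h4 : b = a := congrArg Prod.snd hcomp
    have h5 := huniq (x, y) ⟨h1, h3, hx, hy⟩
    obtain ⟨rfl, rfl⟩ := Prod.mk.inj h5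
    subst h4
    subst h2
    rfl

section Aligned

variable (Λ : TopKGraph.{u, v} k)

/-- The set `U W` of all compositions of paths of `U` with paths of `W`. -/
def prodSet (U W : Set Λ.Mor) : Set Λ.Mor :=
  {f | ∃ g ∈ U, ∃ g' ∈ W, ∃ h : Λ.s g = Λ.r g', Λ.comp g g' h = f}

/-- The paths of degree `m`. -/
def degSet (m : Fin k → ℕ) : Set Λ.Mor := {f | Λ.deg f = m}

/-- `U ∨ V`, the minimal common extensions of paths from `U ⊆ Λ^p` and `V ⊆ Λ^q`. -/
def minExtSet (p q : Fin k → ℕ) (U V : Set Λ.Mor) : Set Λ.Mor :=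
  Λ.prodSet U (Λ.degSet (p ⊔ q - p)) ∩ Λ.prodSet V (Λ.degSet (p ⊔ q - q))

/-- `Λ` is compactly aligned. -/
def CompactlyAligned : Prop :=
  ∀ (p q : Fin k → ℕ) (U V : Set Λ.Mor), U ⊆ Λ.degSet p → V ⊆ Λ.degSet q →
    IsCompact U → IsCompact V → IsCompact (Λ.minExtSet p q U V)

/-- `Λ^min(f, g)`. -/
def minExt (f g : Λ.Mor) : Set (Λ.Mor × Λ.Mor) :=
  {p | ∃ (h : Λ.s f = Λ.r p.1) (h' : Λ.s g = Λ.r p.2),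
    Λ.comp f p.1 h = Λ.comp g p.2 h' ∧ Λ.deg (Λ.comp f p.1 h) = Λ.deg f ⊔ Λ.deg g}

/-- `E` is exhaustive for the set `V` of vertices. -/
def Exhaustive (E : Set Λ.Mor) (V : Set Λ.Obj) : Prop :=
  (∀ g ∈ E, Λ.r g ∈ V) ∧ ∀ f, Λ.r f ∈ V → ∃ g ∈ E, (Λ.minExt f g).Nonempty

/-- `a 𝒞ℰ(Λ)`: the compact sets `E` of paths such that `r(E)` is a neighbourhood of the vertex
`a` and `E` is exhaustive for `r(E)`. -/
def CE (a : Λ.Obj) : Set (Set Λ.Mor) :=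
  {E | IsCompact E ∧ Λ.r '' E ∈ 𝓝 a ∧ Λ.Exhaustive E (Λ.r '' E)}

end Aligned

/-! ## The path space -/

/-- The inclusion of `ℕ^k` in `(ℕ ∪ {∞})^k`. -/
abbrev toENat (p : Fin k → ℕ) : Fin k → ℕ∞ := fun i => (p i : ℕ∞)

/-- An element `x` of the path space `X_Λ`: a degree-preserving functor `x : Ω_{k,m} → Λ`, where
`m = deg`.  The objects of `Ω_{k,m}` are the `p ∈ ℕ^k` with `p ≤ m`; its morphisms are the pairs
`(p, q)` with `p ≤ q ≤ m`, of range `p`, source `q` and degree `q - p`, with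
`(n, p) (p, q) = (n, q)`.  Since `Ω_{k,m}` is discrete, every such functor is continuous. -/
structure Path (Λ : TopKGraph.{u, v} k) where
  deg : Fin k → ℕ∞
  obj : ∀ p : Fin k → ℕ, toENat p ≤ deg → Λ.Obj
  map : ∀ p q : Fin k → ℕ, p ≤ q → toENat q ≤ deg → Λ.Mor
  r_map : ∀ p q hpq hq (hp : toENat p ≤ deg), Λ.r (map p q hpq hq) = obj p hp
  s_map : ∀ p q hpq hq, Λ.s (map p q hpq hq) = obj q hq
  map_self : ∀ p hp, map p p le_rfl hp = Λ.one (obj p hp)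
  map_comp : ∀ n p q (hnp : n ≤ p) (hpq : p ≤ q) (hp : toENat p ≤ deg) (hq : toENat q ≤ deg),
    map n q (hnp.trans hpq) hq
      = Λ.comp (map n p hnp hp) (map p q hpq hq) ((s_map n p hnp hp).trans (r_map p q hpq hq hp).symm)
  deg_map : ∀ p q hpq hq, Λ.deg (map p q hpq hq) = q - p

namespace Path

variable {Λ : TopKGraph.{u, v} k}

theorem ext' {x y : Λ.Path} (hd : x.deg = y.deg)
    (hm : ∀ p q hpq hx hy, x.map p q hpq hx = y.map p q hpq hy) : x = y := by
  obtain ⟨d, o, m, h1, h2, h3, h4, h5⟩ := x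
  obtain ⟨d', o', m', h1', h2', h3', h4', h5'⟩ := y
  obtain rfl : d = d' := hd
  have hmm : m = m' := by
    funext p q hpq hq
    exact hm p q hpq hq hq
  subst hmm
  have ho : o = o' := by
    funext p hp
    rw [← h2 p p le_rfl hp, ← h2' p p le_rfl hp]
  subst ho
  rfl

theorem le_add_iff {m q : Fin k → ℕ} {d : Fin k → ℕ∞} (h : toENat m ≤ d) :
    toENat q ≤ d - toENat m ↔ toENat (m + q) ≤ d := by
  have key : ∀ (a b : ℕ) (t : ℕ∞), (a : ℕ∞) ≤ t →
      ((b : ℕ∞) ≤ t - (a : ℕ∞) ↔ ((a + b : ℕ) : ℕ∞) ≤ t) := by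
    intro a b t hat
    induction t using ENat.recTopCoe with
    | top => simp
    | coe n => norm_cast at hat ⊢; omega
  exact ⟨fun hq i => (key _ _ _ (h i)).1 (hq i), fun hq i => (key _ _ _ (h i)).2 (hq i)⟩

/-- The shift `σ^m x`, of degree `d(x) - m`, given by `(σ^m x)(p, q) = x(m + p, m + q)`. -/
def shift (x : Λ.Path) (m : Fin k → ℕ) (h : toENat m ≤ x.deg) : Λ.Path where
  deg := x.deg - toENat m
  obj p hp := x.obj (m + p) ((le_add_iff h).1 hp)
  map p q hpq hq := x.map (m + p) (m + q) (add_le_add_right hpq m) ((le_add_iff h).1 hq)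
  r_map p q hpq hq hp := x.r_map _ _ _ _ _
  s_map p q hpq hq := x.s_map _ _ _ _
  map_self p hp := x.map_self _ _
  map_comp n p q hnp hpq hp hq := x.map_comp _ _ _ _ _ _ _
  deg_map p q hpq hq := by rw [x.deg_map]; exact add_tsub_add_eq_tsub_left m q p

/-- `z = f x`: the path `z` is the concatenation of the morphism `f` with the path `x`, i.e.
`z(0, d(f)) = f` and `σ^{d(f)} z = x`. -/
def IsConcat (z : Λ.Path) (f : Λ.Mor) (x : Λ.Path) : Prop :=
  ∃ h : toENat (Λ.deg f) ≤ z.deg, z.map 0 (Λ.deg f) zero_le h = f ∧ z.shift (Λ.deg f) h = x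

/-- `x` is a boundary path. -/
def IsBoundary (x : Λ.Path) : Prop :=
  ∀ (m : Fin k → ℕ) (hm : toENat m ≤ x.deg), ∀ E ∈ Λ.CE (x.obj m hm), ∃ f ∈ E,
    ∃ h : toENat (m + Λ.deg f) ≤ x.deg, x.map m (m + Λ.deg f) le_self_add h = f

theorem map_congr (x : Λ.Path) {p p' q q' : Fin k → ℕ} (h1 : p = p') (h2 : q = q') (hpq hq) :
    x.map p q hpq hq = x.map p' q' (h1 ▸ h2 ▸ hpq) (h2 ▸ hq) := by
  subst h1; subst h2; rfl

theorem shift_congr (x : Λ.Path) {m m' : Fin k → ℕ} (h : m = m') (hm) :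
    x.shift m hm = x.shift m' (h ▸ hm) := by
  subst h; rfl

theorem shift_shift (x : Λ.Path) (m n : Fin k → ℕ) (hm) (hn : toENat n ≤ (x.shift m hm).deg) :
    (x.shift m hm).shift n hn = x.shift (m + n) ((le_add_iff hm).1 hn) := by
  refine ext' ?_ ?_
  · funext i
    simp [shift, toENat, tsub_tsub]
  · intro p q hpq hx hy
    exact x.map_congr (add_assoc _ _ _).symm (add_assoc _ _ _).symm _ _

theorem isConcat_shift (x : Λ.Path) (p : Fin k → ℕ) (hp : toENat p ≤ x.deg) :
    x.IsConcat (x.map 0 p zero_le hp) (x.shift p hp) := by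
  have h : Λ.deg (x.map 0 p zero_le hp) = p := by rw [x.deg_map, tsub_zero]
  refine ⟨by rw [h]; exact hp, x.map_congr rfl h _ _, x.shift_congr h _⟩

/-- Extending the initial segment of a concatenation. -/
theorem IsConcat.extend {z x : Λ.Path} {f : Λ.Mor} (h : z.IsConcat f x) (a : Fin k → ℕ)
    (ha : toENat a ≤ x.deg) :
    ∃ g, Λ.deg g = Λ.deg f + a ∧ z.IsConcat g (x.shift a ha) ∧
      ∃ hs : Λ.s f = Λ.r (x.map 0 a zero_le ha),
        g = Λ.comp f (x.map 0 a zero_le ha) hs := by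
  obtain ⟨h1, h2, rfl⟩ := h
  have ha' := (le_add_iff h1).1 ha
  refine ⟨z.map 0 (Λ.deg f + a) zero_le ha', by rw [z.deg_map, tsub_zero], ?_, ?_⟩
  · rw [shift_shift]
    exact z.isConcat_shift _ _
  · have e : (z.shift (Λ.deg f) h1).map 0 a zero_le ha
        = z.map (Λ.deg f) (Λ.deg f + a) le_self_add ha' :=
      z.map_congr (add_zero _) rfl _ _
    have hs : Λ.s f = Λ.r ((z.shift (Λ.deg f) h1).map 0 a zero_le ha) := by
      rw [e, z.r_map _ _ _ _ h1]
      conv_lhs => rw [← h2]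
      exact z.s_map _ _ _ _
    refine ⟨hs, ?_⟩
    rw [z.map_comp 0 (Λ.deg f) _ zero_le le_self_add h1 ha']
    congr 1

end Path

/-! ## The path groupoid -/

section PathGroupoid

variable (Λ : TopKGraph.{u, v} k)

/-- The integer vector `d(f) - d(g)`. -/
def degDiff (f g : Λ.Mor) : Fin k → ℤ := fun i => (Λ.deg f i : ℤ) - (Λ.deg g i : ℤ)

/-- The morphisms of the path groupoid: the triples `(f x, d(f) - d(g), g x)`, where `f`, `g` are
morphisms with `s(f) = s(g)` and `x` is a path with `r(x) = s(f)`. -/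
def PathArrow : Type (max u v) :=
  {t : Λ.Path × (Fin k → ℤ) × Λ.Path //
    ∃ (f g : Λ.Mor) (x : Λ.Path), Λ.s f = Λ.s g ∧ t.1.IsConcat f x ∧ t.2.2.IsConcat g x ∧
      t.2.1 = Λ.degDiff f g}

/-- `U *_s V`, the set of pairs in `U × V` with a common source. -/
def starS (U V : Set Λ.Mor) : Set (Λ.Mor × Λ.Mor) := {p | p.1 ∈ U ∧ p.2 ∈ V ∧ Λ.s p.1 = Λ.s p.2}

/-- `Z(F, m)`, the set of all `(f x, d(f) - d(g), g x)` with `(f, g) ∈ F` and `d(f) - d(g) = m`. -/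
def Z (F : Set (Λ.Mor × Λ.Mor)) (m : Fin k → ℤ) : Set Λ.PathArrow :=
  {t | ∃ (f g : Λ.Mor) (x : Λ.Path), (f, g) ∈ F ∧ t.1.1.IsConcat f x ∧ t.1.2.2.IsConcat g x ∧
    t.1.2.1 = Λ.degDiff f g ∧ Λ.degDiff f g = m}

/-- The topology on `G_Λ` with basic open sets `Z(U *_s V, m) ∩ Z(F, m)ᶜ`, where `U` and `V` are
open and `F ⊆ Λ *_s Λ` is compact. -/
instance : TopologicalSpace Λ.PathArrow :=
  TopologicalSpace.generateFrom
    {S | ∃ (m : Fin k → ℤ) (U V : Set Λ.Mor) (F : Set (Λ.Mor × Λ.Mor)), IsOpen U ∧ IsOpen V ∧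
      IsCompact F ∧ F ⊆ Λ.starS Set.univ Set.univ ∧ S = Λ.Z (Λ.starS U V) m ∩ (Λ.Z F m)ᶜ}

variable {Λ}

theorem src_eq {z w x : Λ.Path} {f g : Λ.Mor} (h : z.IsConcat f x) (h' : w.IsConcat g x) :
    Λ.s f = Λ.s g := by
  obtain ⟨hs, -⟩ := (h.extend 0 (fun i => by simp)).choose_spec.2.2
  obtain ⟨hs', -⟩ := (h'.extend 0 (fun i => by simp)).choose_spec.2.2
  exact hs.trans hs'.symm

theorem isConcat_refl (x : Λ.Path) :
    ∃ (f : Λ.Mor) (y : Λ.Path), x.IsConcat f y ∧ f = Λ.one (x.obj 0 (fun i => by simp)) :=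
  ⟨_, _, x.isConcat_shift 0 (fun i => by simp), x.map_self _ _⟩

/-- Two decompositions of the same path have a common refinement. -/
theorem refine_pair {w x y : Λ.Path} {g g' : Λ.Mor} (h : w.IsConcat g x)
    (h' : w.IsConcat g' y) :
    ∃ (a b : Fin k → ℕ) (ha : toENat a ≤ x.deg) (hb : toENat b ≤ y.deg),
      Λ.deg g + a = Λ.deg g' + b ∧ x.shift a ha = y.shift b hb := by
  obtain ⟨h1, h2, rfl⟩ := h
  obtain ⟨h1', h2', rfl⟩ := h'
  have e1 : Λ.deg g + (Λ.deg g ⊔ Λ.deg g' - Λ.deg g) = Λ.deg g ⊔ Λ.deg g' :=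
    add_tsub_cancel_of_le le_sup_left
  have e2 : Λ.deg g' + (Λ.deg g ⊔ Λ.deg g' - Λ.deg g') = Λ.deg g ⊔ Λ.deg g' :=
    add_tsub_cancel_of_le le_sup_right
  have hsup : toENat (Λ.deg g ⊔ Λ.deg g') ≤ w.deg := by
    intro i
    rcases le_total (Λ.deg g i) (Λ.deg g' i) with hle | hle
    · simpa [toENat, hle] using h1' i
    · simpa [toENat, hle] using h1 i
  refine ⟨_, _, (Path.le_add_iff h1).2 (by rw [e1]; exact hsup),
    (Path.le_add_iff h1').2 (by rw [e2]; exact hsup), e1.trans e2.symm, ?_⟩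
  exact (w.shift_shift _ _ h1 _).trans
    ((w.shift_congr (e1.trans e2.symm) _).trans (w.shift_shift _ _ h1' _).symm)

theorem pathArrow_comp_aux {z w v : Λ.Path} {m n : Fin k → ℤ}
    (h : ∃ (f g : Λ.Mor) (x : Λ.Path), Λ.s f = Λ.s g ∧ z.IsConcat f x ∧ w.IsConcat g x ∧
      m = Λ.degDiff f g)
    (h' : ∃ (f g : Λ.Mor) (x : Λ.Path), Λ.s f = Λ.s g ∧ w.IsConcat f x ∧ v.IsConcat g x ∧
      n = Λ.degDiff f g) :
    ∃ (f g : Λ.Mor) (x : Λ.Path), Λ.s f = Λ.s g ∧ z.IsConcat f x ∧ v.IsConcat g x ∧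
      m + n = Λ.degDiff f g := by
  obtain ⟨f, g, x, -, hz, hw, rfl⟩ := h
  obtain ⟨f', g', y, -, hw', hv, rfl⟩ := h'
  obtain ⟨a, b, ha, hb, hab, hxy⟩ := refine_pair hw hw'
  obtain ⟨f₁, hd, hf₁, -⟩ := hz.extend a ha
  obtain ⟨g₁, hd', hg₁, -⟩ := hv.extend b hb
  rw [← hxy] at hg₁
  refine ⟨f₁, g₁, _, src_eq hf₁ hg₁, hf₁, hg₁, ?_⟩
  funext i
  have := congrFun hab i
  simp only [degDiff, hd, hd', Pi.add_apply] at this ⊢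
  push_cast
  omega

variable (Λ)

/-- The path groupoid `G_Λ`: objects are paths, `r(x, m, y) = x`, `s(x, m, y) = y`,
`(x, m, y) (y, n, z) = (x, m + n, z)` and `(x, m, y)⁻¹ = (y, -m, x)`. -/
def pathGroupoid : TopGroupoid.{max u v, max u v} where
  Obj := Λ.Path
  Mor := Λ.PathArrow
  r t := t.1.1
  s t := t.1.2.2
  one x := ⟨(x, 0, x), by
    obtain ⟨f, y, h, -⟩ := isConcat_refl x
    exact ⟨f, f, y, rfl, h, h, by funext i; simp [degDiff]⟩⟩
  comp t t' h := ⟨(t.1.1, t.1.2.1 + t'.1.2.1, t'.1.2.2), by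
    have h2 := t'.2
    rw [← h] at h2
    exact pathArrow_comp_aux t.2 h2⟩
  r_one x := rfl
  s_one x := rfl
  r_comp t t' h := rfl
  s_comp t t' h := rfl
  one_comp t := Subtype.ext (by simp)
  comp_one t := Subtype.ext (by simp)
  assoc t t' t'' h h' := Subtype.ext (by simp [add_assoc])
  inv t := ⟨(t.1.2.2, -t.1.2.1, t.1.1), by
    obtain ⟨f, g, x, hs, h, h', hm⟩ := t.2
    exact ⟨g, f, x, hs.symm, h', h, by rw [hm]; funext i; simp [degDiff]⟩⟩
  r_inv t := rfl
  s_inv t := rfl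
  inv_comp t := Subtype.ext (by simp)
  comp_inv t := Subtype.ext (by simp)

/-- The set `∂Λ` of boundary paths. -/
def boundary : Set Λ.pathGroupoid.Obj := {x : Λ.Path | x.IsBoundary}

/-- The boundary-path groupoid `𝒢_Λ`, the reduction of `G_Λ` to `∂Λ`. -/
def boundaryGroupoid : TopGroupoid.{max u v, max u v} := Λ.pathGroupoid.reduction Λ.boundary

variable {Λ}
variable {A : Type w} [Group A] [TopologicalSpace A]

/-- The value of the induced cocycle: `c̃(f x, d(f) - d(g), g x) = c(f) c(g)⁻¹`, computed from any
decomposition. -/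
noncomputable def inducedFun (c : ContFunctor Λ.toArrCat A) (t : Λ.PathArrow) : A :=
  c.toFun t.2.choose * (c.toFun t.2.choose_spec.choose)⁻¹

theorem cocycle_wd (c : ContFunctor Λ.toArrCat A) {z w x x' : Λ.Path} {f g f' g' : Λ.Mor}
    (h1 : z.IsConcat f x) (h2 : w.IsConcat g x) (h1' : z.IsConcat f' x') (h2' : w.IsConcat g' x')
    (hd : Λ.degDiff f g = Λ.degDiff f' g') :
    c.toFun f * (c.toFun g)⁻¹ = c.toFun f' * (c.toFun g')⁻¹ := by
  obtain ⟨a, b, ha, hb, hab, hxy⟩ := refine_pair h1 h1'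
  have huniq : ∀ {z y y' : Λ.Path} {p q : Λ.Mor}, z.IsConcat p y → z.IsConcat q y' →
      Λ.deg p = Λ.deg q → p = q := by
    rintro z y y' p q ⟨e1, e2, -⟩ ⟨e1', e2', -⟩ hpq
    rw [← e2, ← e2']
    exact z.map_congr rfl hpq _ _
  obtain ⟨F, hF, cF, sF, eF⟩ := h1.extend a ha
  obtain ⟨F', hF', cF', sF', eF'⟩ := h1'.extend b hb
  obtain ⟨K, hK, cK, sK, eK⟩ := h2.extend a ha
  obtain ⟨K', hK', cK', sK', eK'⟩ := h2'.extend b hb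
  have h3 : F = F' := huniq cF cF' (by rw [hF, hF', hab])
  have h4 : K = K' := huniq cK cK' (by
    rw [hK, hK']
    funext i
    have e1 := congrFun hab i
    have e2 := congrFun hd i
    simp only [degDiff, Pi.add_apply] at e1 e2 ⊢
    omega)
  have c1 : c.toFun F * (c.toFun K)⁻¹ = c.toFun f * (c.toFun g)⁻¹ := by
    rw [eF, eK, c.map_comp, c.map_comp]; group
  have c2 : c.toFun F' * (c.toFun K')⁻¹ = c.toFun f' * (c.toFun g')⁻¹ := by
    rw [eF', eK', c.map_comp, c.map_comp]; group
  rw [← c1, ← c2, h3, h4]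

theorem inducedFun_eq (c : ContFunctor Λ.toArrCat A) (t : Λ.PathArrow) {f g : Λ.Mor} {x : Λ.Path}
    (h1 : t.1.1.IsConcat f x) (h2 : t.1.2.2.IsConcat g x) (hd : t.1.2.1 = Λ.degDiff f g) :
    inducedFun c t = c.toFun f * (c.toFun g)⁻¹ := by
  obtain ⟨-, e1, e2, e3⟩ := t.2.choose_spec.choose_spec.choose_spec
  exact cocycle_wd c e1 e2 h1 h2 (e3.symm.trans hd)

/-- The continuous functor `c̃ : G_Λ → A` induced by a continuous functor `c : Λ → A`. -/
noncomputable def inducedCocycle [IsTopologicalGroup A] (c : ContFunctor Λ.toArrCat A) :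
    ContFunctor Λ.pathGroupoid.toArrCat A where
  toFun := inducedFun c
  map_one x := by
    obtain ⟨f, y, h, -⟩ := isConcat_refl x
    rw [inducedFun_eq c (Λ.pathGroupoid.one x) (f := f) (g := f) (x := y) h h
      (by funext i; simp [degDiff, pathGroupoid])]
    group
  map_comp := by
    rintro ⟨⟨z, m, w⟩, ht⟩ ⟨⟨w', n, v⟩, ht'⟩ h
    obtain rfl : w = w' := h
    obtain ⟨f, g, x, -, hz, hw, hm⟩ := id ht
    obtain ⟨f', g', y, -, hw', hv, hn⟩ := id ht'
    dsimp only at hz hw hm hw' hv hn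
    obtain ⟨a, b, ha, hb, hab, hxy⟩ := refine_pair hw hw'
    obtain ⟨F, hF, cF, sF, eF⟩ := hz.extend a ha
    obtain ⟨K, hK, cK, sK, eK⟩ := hw.extend a ha
    obtain ⟨K', hK', cK', sK', eK'⟩ := hw'.extend b hb
    obtain ⟨L, hL, cL, sL, eL⟩ := hv.extend b hb
    have hKK : K = K' := by
      obtain ⟨_, e2, -⟩ := cK
      obtain ⟨_, e2', -⟩ := cK'
      rw [← e2, ← e2']
      exact w.map_congr rfl (by rw [hK, hK', hab]) _ _
    rw [← hxy] at cL
    refine (inducedFun_eq c _ (f := F) (g := L) cF cL ?_).trans ?_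
    · funext i
      have e := congrFun hab i
      change m i + n i = _
      simp only [hm, hn, degDiff, hF, hL, Pi.add_apply] at e ⊢
      push_cast
      omega
    refine Eq.trans ?_ (congrArg₂ (· * ·) (inducedFun_eq c _ (f := f) (g := g) hz hw hm)
      (inducedFun_eq c _ (f := f') (g := g') hw' hv hn)).symm
    have c1 : c.toFun F * (c.toFun K)⁻¹ = c.toFun f * (c.toFun g)⁻¹ := by
      rw [eF, eK, c.map_comp, c.map_comp]; group
    have c2 : c.toFun K' * (c.toFun L)⁻¹ = c.toFun f' * (c.toFun g')⁻¹ := by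
      rw [eK', eL, c.map_comp, c.map_comp]; group
    rw [← c1, ← c2, hKK]; group
  continuous_toFun := by
    change Continuous (inducedFun c)
    rw [continuous_iff_continuousAt]
    intro t W hW
    obtain ⟨f, g, x, hs, h1, h2, hd⟩ := t.2
    rw [inducedFun_eq c t h1 h2 hd] at hW
    have hcont : Continuous fun p : Λ.Mor × Λ.Mor => c.toFun p.1 * (c.toFun p.2)⁻¹ := by
      have := c.continuous_toFun
      fun_prop
    have hN := hcont.continuousAt (x := (f, g)) hW
    rw [Filter.mem_map, mem_nhds_prod_iff'] at hN
    obtain ⟨U, V, hU, hfU, hV, hgV, hUV⟩ := hN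
    have hO : IsOpen (Λ.Z (Λ.starS U V) t.1.2.1 ∩ (Λ.Z ∅ t.1.2.1)ᶜ) :=
      TopologicalSpace.isOpen_generateFrom_of_mem
        ⟨_, U, V, ∅, hU, hV, isCompact_empty, Set.empty_subset _, rfl⟩
    rw [Filter.mem_map]
    refine Filter.mem_of_superset (hO.mem_nhds ⟨⟨f, g, x, ⟨hfU, hgV, hs⟩, h1, h2, hd, hd.symm⟩, ?_⟩)
      ?_
    · rintro ⟨_, _, _, h, -⟩
      exact h
    · rintro t' ⟨⟨f', g', x', ⟨hf', hg', -⟩, h1', h2', hd', -⟩, -⟩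
      change inducedFun c t' ∈ W
      rw [inducedFun_eq c t' h1' h2' hd']
      exact hUV (Set.mk_mem_prod hf' hg')

end PathGroupoid

end TopKGraph

end HRGraph

/-! A path in `Λ ×_c A` is a path `x` of `Λ` together with the group coordinate `a` of its range:
the coordinate at `x(p)` is forced to be `a c(x(0,p))`. Likewise, an arrow over `t : x ← y` is
determined by `t` and the coordinate `a` of its range, and the coordinate of its source is then `a
c̃(t)`. This is exactly the rule of the skew product `G_Λ(c̃)`, so the algebraic isomorphism is `(t,
a) ↦ liftArrow c t a`, with inverse `t ↦ (projArrow t, t.1.1.range.2)`.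

The topological content lies in the removed sets `Z(F, m)` with `F` compact. `liftArrow_mem_Z` and
`projArrow_mem_Z` describe the preimages of all sets `Z`; the open parts `Z(U *_s V, m)` then cause
no trouble. For the lift, `isClosed_setOf_mem_Z` shows that the preimage of `Z(F, m)` is closed. It
uses that a compact set contains only finitely many pairs decomposing a given arrow, together with
local compactness of `A`. For the projection, the set to be removed upstairs is not compact in the
direction of `A`, but near a given arrow it may be cut down to a compact neighbourhood of the group
coordinate.

For the second isomorphism it suffices that `x.lift c a` is a boundary path iff `x` is
(`isBoundary_lift_iff`). Compact exhaustive sets pass upstairs as products `E × N` and downstairs as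
slices at a fixed coordinate, because minimal common extensions preserve the coordinate of the
range. -/

namespace HRGraph

open Topology

/-! ### Constructing and restricting isomorphisms of topological groupoids. -/

namespace TopGroupoid

/-- An isomorphism of groupoids which is a homeomorphism on morphisms is an isomorphism of
topological groupoids. -/
def Iso.ofMor {G H : TopGroupoid} (obj : G.Obj ≃ H.Obj) (mor : G.Mor ≃ₜ H.Mor)
    (map_r : ∀ f, H.r (mor f) = obj (G.r f)) (map_s : ∀ f, H.s (mor f) = obj (G.s f))
    (map_one : ∀ a, mor (G.one a) = H.one (obj a))
    (map_comp : ∀ (f g : G.Mor) (h : G.s f = G.r g), mor (G.comp f g h)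
      = H.comp (mor f) (mor g) ((map_s f).trans ((congrArg obj h).trans (map_r g).symm))) :
    Iso G H where
  obj :=
    { obj with
      -- The topology on units is induced by `one`, so continuity on units follows from continuity
      -- on morphisms.
      continuous_toFun := continuous_induced_rng.2 <| by
        have e : H.one ∘ obj = mor ∘ G.one := funext fun a => (map_one a).symm
        exact e ▸ mor.continuous.comp continuous_induced_dom
      continuous_invFun := continuous_induced_rng.2 <| by
        have e : G.one ∘ obj.symm = mor.symm ∘ H.one := funext fun a => by
          simp [Homeomorph.eq_symm_apply, map_one]
        exact e ▸ mor.symm.continuous.comp continuous_induced_dom }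
  mor := mor
  map_r := map_r
  map_s := map_s
  map_one := map_one
  map_comp := map_comp

/-- An isomorphism `G(b) ≅ H` which matches `Y × A` with `Y'` restricts to an isomorphism
`(G|_Y)(b) ≅ H|_{Y'}`. -/
def Iso.restrictSkew {G H : TopGroupoid} {A : Type*} [Group A] [TopologicalSpace A]
    {b : ContFunctor G.toArrCat A} (φ : Iso (G.skew b) H) (Y : Set G.Obj) (Y' : Set H.Obj)
    (hY : ∀ (y : G.Obj) (a : A), φ.obj (y, a) ∈ Y' ↔ y ∈ Y) :
    Iso ((G.reduction Y).skew (restrict b Y)) (H.reduction Y') :=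
  have hr : ∀ p : G.Mor × A, H.r (φ.mor p) ∈ Y' ↔ G.r p.1 ∈ Y := fun p => by
    exact (iff_of_eq (congrArg (· ∈ Y') (φ.map_r p))).trans (hY (G.r p.1) p.2)
  -- The source of `(γ, g)` has coordinate `g b(γ)` instead of `g`; this is harmless since `hY`
  -- holds for every group element.
  have hs : ∀ p : G.Mor × A, H.s (φ.mor p) ∈ Y' ↔ G.s p.1 ∈ Y := fun p => by
    exact (iff_of_eq (congrArg (· ∈ Y') (φ.map_s p))).trans
      (hY (G.s p.1) (p.2 * b.toFun p.1))
  Iso.ofMor (G := (G.reduction Y).skew (restrict b Y)) (H := H.reduction Y')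
    { toFun := fun p => ⟨φ.obj (p.1.1, p.2), (hY _ _).2 p.1.2⟩
      invFun := fun q => (⟨(φ.obj.symm q.1).1, (hY _ (φ.obj.symm q.1).2).1 
        (show φ.obj (φ.obj.symm q.1) ∈ Y' from (φ.obj.apply_symm_apply q.1).symm ▸ q.2)⟩, (φ.obj.symm q.1).2)
      left_inv := fun p => by
        have e := φ.obj.symm_apply_apply (p.1.1, p.2)
        exact Prod.ext (Subtype.ext (congrArg (Prod.fst : G.Obj × A → G.Obj) e))
          (congrArg (Prod.snd : G.Obj × A → A) e)
      right_inv := fun q => Subtype.ext (φ.obj.apply_symm_apply q.1) }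
    { toFun := fun p => ⟨φ.mor (p.1.1, p.2), (hr _).2 p.1.2.1, (hs _).2 p.1.2.2⟩
      invFun := fun q => (⟨(φ.mor.symm q.1).1,
        (hr (φ.mor.symm q.1)).1 ((φ.mor.apply_symm_apply q.1).symm ▸ q.2.1),
        (hs (φ.mor.symm q.1)).1 ((φ.mor.apply_symm_apply q.1).symm ▸ q.2.2)⟩,
        (φ.mor.symm q.1).2)
      left_inv := fun p => by
        have e := φ.mor.symm_apply_apply (p.1.1, p.2)
        exact Prod.ext (Subtype.ext (congrArg (Prod.fst : G.Mor × A → G.Mor) e))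
          (congrArg (Prod.snd : G.Mor × A → A) e)
      right_inv := fun q => Subtype.ext (φ.mor.apply_symm_apply q.1)
      continuous_toFun := Continuous.subtype_mk (φ.mor.continuous.comp
        ((continuous_subtype_val.comp continuous_fst).prodMk continuous_snd)) _
      continuous_invFun := by
        have h := φ.mor.symm.continuous.comp (continuous_subtype_val
          (p := fun f : H.Mor => H.r f ∈ Y' ∧ H.s f ∈ Y'))
        exact (Continuous.subtype_mk (continuous_fst.comp h) _).prodMk (continuous_snd.comp h) }
    (fun p => Subtype.ext (φ.map_r (p.1.1, p.2)))
    (fun p => Subtype.ext (φ.map_s (p.1.1, p.2)))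
    (fun p => Subtype.ext (φ.map_one (p.1.1, p.2)))
    (fun p q h => Subtype.ext (φ.map_comp (p.1.1, p.2) (q.1.1, q.2)
      (Prod.ext (congrArg (fun z : Y × A => z.1.1) h) (congrArg (Prod.snd : Y × A → A) h))))

end TopGroupoid

namespace TopKGraph

variable {k : ℕ} {Λ : TopKGraph.{u, v} k} {A : Type w} [Group A] [TopologicalSpace A]
  [IsTopologicalGroup A] [LocallyCompactSpace A] [T2Space A] {c : ContFunctor Λ.toArrCat A}

/-! ### Lifting and projecting paths. -/

namespace Path

/-- The range `x(0)` of a path. -/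
def range (x : Λ.Path) : Λ.Obj := x.obj 0 (fun i => by simp)

variable (c) in
/-- The path of the skew product over `x` with range `(r(x), a)`. -/
def lift (x : Λ.Path) (a : A) : (Λ.skew c).Path where
  deg := x.deg
  obj p hp := (x.obj p hp, a * c.toFun (x.map 0 p zero_le hp))
  -- A morphism `(f, a)` carries the coordinate of its range, hence `x(0,p)` here and not `x(0,q)`.
  map p q hpq hq := (x.map p q hpq hq, a * c.toFun (x.map 0 p zero_le
    (le_trans (fun i => Nat.cast_le.2 (hpq i)) hq)))
  r_map p q hpq hq hp := Prod.ext (x.r_map _ _ _ _ _) rfl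
  s_map p q hpq hq := Prod.ext (x.s_map _ _ _ _) <| by
    rw [x.map_comp 0 p q zero_le hpq (le_trans (fun i => Nat.cast_le.2 (hpq i)) hq) hq,
      c.map_comp, ← mul_assoc]
    rfl
  map_self p hp := Prod.ext (x.map_self _ _) rfl
  map_comp n p q hnp hpq hp hq := Prod.ext (x.map_comp _ _ _ _ _ _ _) rfl
  deg_map p q hpq hq := x.deg_map _ _ _ _

/-- The projection of a path of the skew product to `Λ`. -/
def proj (y : (Λ.skew c).Path) : Λ.Path where
  deg := y.deg
  obj p hp := (y.obj p hp).1
  map p q hpq hq := (y.map p q hpq hq).1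
  r_map p q hpq hq hp := congrArg Prod.fst (y.r_map p q hpq hq hp)
  s_map p q hpq hq := congrArg Prod.fst (y.s_map p q hpq hq)
  map_self p hp := congrArg Prod.fst (y.map_self p hp)
  map_comp n p q hnp hpq hp hq := congrArg Prod.fst (y.map_comp n p q hnp hpq hp hq)
  deg_map p q hpq hq := y.deg_map p q hpq hq

/-- Unique lifting: the initial segment ending at `p` multiplies the coordinate of the range by the
value of `c`, so a path upstairs is recovered from its projection and one group element. -/
theorem snd_obj (y : (Λ.skew c).Path) (p : Fin k → ℕ) (hp : toENat p ≤ y.deg) :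
    (y.obj p hp).2 = y.range.2 * c.toFun (y.map 0 p zero_le hp).1 := by
  have h1 : (y.map 0 p zero_le hp).2 = y.range.2 :=
    congrArg Prod.snd (y.r_map 0 p zero_le hp _)
  have h2 : (y.map 0 p zero_le hp).2 * c.toFun (y.map 0 p zero_le hp).1 = (y.obj p hp).2 :=
    congrArg Prod.snd (y.s_map 0 p zero_le hp)
  rw [← h2, h1]

theorem range_lift_snd (x : Λ.Path) (a : A) : (x.lift c a).range.2 = a := by
  change a * c.toFun (x.map 0 0 zero_le (fun i => by simp)) = a
  rw [x.map_self, c.map_one, mul_one]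

theorem lift_proj (y : (Λ.skew c).Path) : y.proj.lift c y.range.2 = y :=
  ext' rfl fun p q hpq hx hy => Prod.ext rfl <| by
    have hp : toENat p ≤ y.deg := le_trans (fun i => Nat.cast_le.2 (hpq i)) hx
    refine (snd_obj y p hp).symm.trans ?_
    exact (congrArg Prod.snd (y.r_map p q hpq hx hp)).symm

variable (c) in
/-- Paths of the skew product are paths of `Λ` together with an element of the group. -/
def liftEquiv : Λ.Path × A ≃ (Λ.skew c).Path where
  toFun p := p.1.lift c p.2
  invFun y := (y.proj, y.range.2)
  left_inv p := Prod.ext rfl (range_lift_snd p.1 p.2)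
  right_inv y := lift_proj y

/-- The remaining path starts at `s(f, a)`, whose coordinate is `a c(f)`; its further coordinates
agree because `c` is multiplicative on initial segments of `z`. -/
theorem IsConcat.lift {z x : Λ.Path} {f : Λ.Mor} (h : z.IsConcat f x) (a : A) :
    (z.lift c a).IsConcat (f, a) (x.lift c (a * c.toFun f)) := by
  obtain ⟨h1, h2, rfl⟩ := h
  refine ⟨h1, Prod.ext h2 ?_, ext' rfl fun p q hpq hx hy => Prod.ext rfl ?_⟩
  · change a * c.toFun (z.map 0 0 _ _) = a
    rw [z.map_self, c.map_one, mul_one]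
  · have hp := (le_add_iff h1).1 (le_trans (fun i => Nat.cast_le.2 (hpq i)) hx)
    change a * c.toFun (z.map 0 (Λ.deg f + p) _ hp)
      = a * c.toFun f * c.toFun (z.map (Λ.deg f + 0) (Λ.deg f + p) _ _)
    rw [z.map_comp 0 (Λ.deg f) (Λ.deg f + p) zero_le le_self_add h1 hp, c.map_comp, h2, mul_assoc]
    congr 3

theorem IsConcat.proj {z x : (Λ.skew c).Path} {f : (Λ.skew c).Mor} (h : z.IsConcat f x) :
    z.proj.IsConcat f.1 x.proj := by
  obtain ⟨h1, h2, rfl⟩ := h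
  exact ⟨h1, congrArg Prod.fst h2, rfl⟩

theorem IsConcat.range_snd {z x : (Λ.skew c).Path} {f : (Λ.skew c).Mor} (h : z.IsConcat f x) :
    z.range.2 = f.2 := by
  obtain ⟨h1, h2, -⟩ := h
  exact h2 ▸ (congrArg Prod.snd (z.r_map 0 _ zero_le h1 _)).symm

theorem IsConcat.eq_of_deg_eq {z x x' : Λ.Path} {f f' : Λ.Mor} (h : z.IsConcat f x)
    (h' : z.IsConcat f' x') (hd : Λ.deg f = Λ.deg f') : f = f' := by
  obtain ⟨_, e, -⟩ := h
  obtain ⟨_, e', -⟩ := h'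
  rw [← e, ← e']
  exact z.map_congr rfl hd _ _

end Path

/-! ### Arrows of the path groupoid of the skew product -/

variable (c) in
/-- The pair `((f, a), (g, a c(f) c(g)⁻¹))` over the pair `(f, g)`; it has a common source as soon
as `(f, g)` has. -/
def liftPair (p : (Λ.Mor × Λ.Mor) × A) : (Λ.skew c).Mor × (Λ.skew c).Mor :=
  ((p.1.1, p.2), (p.1.2, p.2 * (c.toFun p.1.1 * (c.toFun p.1.2)⁻¹)))

theorem continuous_liftPair : Continuous (liftPair c) := by
  have hc := c.continuous_toFun
  change Continuous fun p : (Λ.Mor × Λ.Mor) × A =>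
    ((p.1.1, p.2), (p.1.2, p.2 * (c.toFun p.1.1 * (c.toFun p.1.2)⁻¹)))
  fun_prop

theorem liftPair_source {f g : Λ.Mor} (h : Λ.s f = Λ.s g) (a : A) :
    (Λ.skew c).s (liftPair c ((f, g), a)).1 = (Λ.skew c).s (liftPair c ((f, g), a)).2 :=
  Prod.ext h <| by
    change a * c.toFun f = a * (c.toFun f * (c.toFun g)⁻¹) * c.toFun g
    group

/-- A common source means `a c(f) = b c(g)`, which determines `b`. So a pair with common source is
known from its projection and its first coordinate. -/
theorem liftPair_of_source {f g : (Λ.skew c).Mor} (h : (Λ.skew c).s f = (Λ.skew c).s g) :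
    liftPair c ((f.1, g.1), f.2) = (f, g) := by
  have h2 : f.2 * c.toFun f.1 = g.2 * c.toFun g.1 := congrArg Prod.snd h
  refine Prod.ext rfl (Prod.ext rfl ?_)
  change f.2 * (c.toFun f.1 * (c.toFun g.1)⁻¹) = g.2
  rw [← mul_assoc, h2, mul_inv_cancel_right]

theorem isConcat_liftPair_snd {w x : Λ.Path} {f g : Λ.Mor} (h : w.IsConcat g x) (a : A) :
    (w.lift c (a * (c.toFun f * (c.toFun g)⁻¹))).IsConcat (liftPair c ((f, g), a)).2
      (x.lift c (a * c.toFun f)) := by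
  have h' := h.lift (c := c) (a * (c.toFun f * (c.toFun g)⁻¹))
  rwa [show a * (c.toFun f * (c.toFun g)⁻¹) * c.toFun g = a * c.toFun f by group] at h'

variable (c) in
/-- The arrow of `G_{Λ ×_c A}` over the arrow `t` of `G_Λ` whose range has group coordinate `a`. -/
noncomputable def liftArrow (t : Λ.PathArrow) (a : A) : (Λ.skew c).PathArrow :=
  ⟨(t.1.1.lift c a, t.1.2.1, t.1.2.2.lift c (a * inducedFun c t)), by
    obtain ⟨f, g, x, hs, h1, h2, hd⟩ := t.2
    refine ⟨(liftPair c ((f, g), a)).1, (liftPair c ((f, g), a)).2, x.lift c (a * c.toFun f),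
      liftPair_source hs a, h1.lift a, ?_, hd⟩
    rw [inducedFun_eq c t h1 h2 hd]
    exact isConcat_liftPair_snd h2 a⟩

/-- The projection of an arrow of `G_{Λ ×_c A}` to `G_Λ`. -/
def projArrow (t : (Λ.skew c).PathArrow) : Λ.PathArrow :=
  ⟨(t.1.1.proj, t.1.2.1, t.1.2.2.proj), by
    obtain ⟨f, g, x, hs, h1, h2, hd⟩ := t.2
    exact ⟨f.1, g.1, x.proj, congrArg Prod.fst hs, h1.proj, h2.proj, hd⟩⟩

theorem liftArrow_projArrow (t : (Λ.skew c).PathArrow) :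
    liftArrow c (projArrow t) t.1.1.range.2 = t := by
  obtain ⟨f, g, x, hs, h1, h2, hd⟩ := t.2
  refine Subtype.ext (Prod.ext (Path.lift_proj _) (Prod.ext rfl ?_))
  change t.1.2.2.proj.lift c (t.1.1.range.2 * inducedFun c (projArrow t)) = t.1.2.2
  have e : t.1.1.range.2 * inducedFun c (projArrow t) = t.1.2.2.range.2 := by
    rw [inducedFun_eq c (projArrow t) h1.proj h2.proj hd, h1.range_snd, h2.range_snd]
    exact congrArg (fun p => p.2.2) (liftPair_of_source hs)
  rw [e, Path.lift_proj]

variable (c) in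
/-- Arrows of `G_{Λ ×_c A}` are arrows of `G_Λ` together with an element of the group. -/
noncomputable def liftArrowEquiv : Λ.PathArrow × A ≃ (Λ.skew c).PathArrow where
  toFun p := liftArrow c p.1 p.2
  invFun t := (projArrow t, t.1.1.range.2)
  left_inv p := Prod.ext rfl (Path.range_lift_snd p.1.1.1 p.2)
  right_inv t := liftArrow_projArrow t

/-- Any pair decomposing an arrow automatically has a common source, and its first coordinate is
that of the range. Hence the pairs upstairs decomposing the lift at `a` are exactly the `liftPair c
(p, a)` with `p` decomposing `t`. -/
theorem liftArrow_mem_Z {t : Λ.PathArrow} {a : A} {m : Fin k → ℤ}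
    {F : Set ((Λ.skew c).Mor × (Λ.skew c).Mor)} :
    liftArrow c t a ∈ (Λ.skew c).Z F m ↔ t ∈ Λ.Z {p | liftPair c (p, a) ∈ F} m := by
  constructor
  · rintro ⟨f, g, x, hF, h1, h2, hd, hm⟩
    refine ⟨f.1, g.1, x.proj, ?_, h1.proj, h2.proj, hd, hm⟩
    have ha : f.2 = a := h1.range_snd.symm.trans (Path.range_lift_snd t.1.1 a)
    change liftPair c ((f.1, g.1), a) ∈ F
    rwa [← ha, liftPair_of_source (src_eq h1 h2)]
  · rintro ⟨f, g, x, hF, h1, h2, hd, hm⟩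
    refine ⟨_, _, x.lift c (a * c.toFun f), hF, h1.lift a, ?_, hd, hm⟩
    change (t.1.2.2.lift c (a * inducedFun c t)).IsConcat _ _
    rw [inducedFun_eq c t h1 h2 hd]
    exact isConcat_liftPair_snd h2 a

/-! ### The topology of the path groupoid -/

theorem isOpen_Z {U V : Set Λ.Mor} (hU : IsOpen U) (hV : IsOpen V) (m : Fin k → ℤ) :
    IsOpen (Λ.Z (Λ.starS U V) m) :=
  TopologicalSpace.isOpen_generateFrom_of_mem
    ⟨m, U, V, ∅, hU, hV, isCompact_empty, Set.empty_subset _, by simp [Z]⟩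

theorem mem_Z_univ (t : Λ.PathArrow) : t ∈ Λ.Z (Λ.starS Set.univ Set.univ) t.1.2.1 := by
  obtain ⟨f, g, x, hs, h1, h2, hd⟩ := t.2
  exact ⟨f, g, x, ⟨trivial, trivial, hs⟩, h1, h2, hd, hd.symm⟩

/-- The generating sets give openness of the complement only inside the arrows of degree `m`; an
arrow of another degree has an open neighbourhood of arrows of its own degree, disjoint from `Z(F,
m)`. -/
theorem isClosed_Z {F : Set (Λ.Mor × Λ.Mor)} (hF : IsCompact F)
    (hFs : F ⊆ Λ.starS Set.univ Set.univ) (m : Fin k → ℤ) : IsClosed (Λ.Z F m) := by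
  rw [← isOpen_compl_iff, isOpen_iff_mem_nhds]
  intro t ht
  by_cases hm : t.1.2.1 = m
  · have ho : IsOpen (Λ.Z (Λ.starS Set.univ Set.univ) m ∩ (Λ.Z F m)ᶜ) :=
      TopologicalSpace.isOpen_generateFrom_of_mem
        ⟨m, _, _, F, isOpen_univ, isOpen_univ, hF, hFs, rfl⟩
    exact Filter.mem_of_superset (ho.mem_nhds ⟨hm ▸ mem_Z_univ t, ht⟩) Set.inter_subset_right
  · refine Filter.mem_of_superset
      ((isOpen_Z isOpen_univ isOpen_univ t.1.2.1).mem_nhds (mem_Z_univ t)) ?_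
    rintro t' ⟨_, _, _, _, _, _, e1, e2⟩ ⟨_, _, _, _, _, _, e1', e2'⟩
    exact hm (e2.symm.trans (e1.symm.trans (e1'.trans e2')))

/-- One decomposing pair witnesses membership, and a product neighbourhood of this pair and the
parameter inside `O` yields a neighbourhood of the arrow and the parameter. -/
theorem isOpen_setOf_mem_Z {B : Type*} [TopologicalSpace B]
    {O : Set ((Λ.Mor × Λ.Mor) × B)} (hO : IsOpen O) (m : Fin k → ℤ) :
    IsOpen {q : Λ.PathArrow × B | q.1 ∈ Λ.Z {p | (p, q.2) ∈ O} m} := by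
  rw [isOpen_iff_mem_nhds]
  rintro ⟨t, a⟩ ⟨f, g, x, hfg, h1, h2, hd, hm⟩
  obtain ⟨W, N, hW, hfW, hN, haN, hWN⟩ := mem_nhds_prod_iff'.1 (hO.mem_nhds hfg)
  obtain ⟨U, V, hU, hfU, hV, hgV, hUV⟩ := mem_nhds_prod_iff'.1 (hW.mem_nhds hfW)
  refine Filter.mem_of_superset (prod_mem_nhds ((isOpen_Z hU hV m).mem_nhds
    ⟨f, g, x, ⟨hfU, hgV, src_eq h1 h2⟩, h1, h2, hd, hm⟩) (hN.mem_nhds haN)) ?_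
  rintro ⟨t', a'⟩ ⟨⟨f', g', x', ⟨hf', hg', -⟩, h'⟩, ha'⟩
  exact ⟨f', g', x', hWN ⟨hUV ⟨hf', hg'⟩, ha'⟩, h'⟩

/-- A compact set of pairs contains only finitely many pairs that decompose a given arrow. -/
theorem finite_decompositions {F : Set (Λ.Mor × Λ.Mor)} (hF : IsCompact F) (t : Λ.PathArrow) :
    {p ∈ F | ∃ x, t.1.1.IsConcat p.1 x ∧ t.1.2.2.IsConcat p.2 x}.Finite := by
  have hc : Continuous fun p : Λ.Mor × Λ.Mor => (Λ.deg p.1, Λ.deg p.2) :=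
    (Λ.continuous_deg.comp continuous_fst).prodMk (Λ.continuous_deg.comp continuous_snd)
  -- The two degrees determine a decomposing pair, and only finitely many degrees occur in a compact
  -- set.
  refine Set.Finite.of_finite_image (f := fun p : Λ.Mor × Λ.Mor => (Λ.deg p.1, Λ.deg p.2))
    (((hF.image hc).finite_of_discrete).subset (Set.image_mono (Set.sep_subset _ _))) ?_
  rintro p ⟨-, x, h1, h2⟩ q ⟨-, y, h1', h2'⟩ hpq
  exact Prod.ext (h1.eq_of_deg_eq h1' (congrArg Prod.fst hpq))
    (h2.eq_of_deg_eq h2' (congrArg Prod.snd hpq))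

/-- The set `F` may vary with a parameter as the slices of a compact `K`. Near a point of the
complement, all slices over a small compact neighbourhood `N` of the parameter are replaced by the
single compact set that is their union, to which `isClosed_Z` applies. -/
theorem isClosed_setOf_mem_Z {B : Type*} [TopologicalSpace B] [LocallyCompactSpace B]
    [T2Space B] {K : Set ((Λ.Mor × Λ.Mor) × B)} (hK : IsCompact K)
    (hKs : Prod.fst '' K ⊆ Λ.starS Set.univ Set.univ) (m : Fin k → ℤ) :
    IsClosed {q : Λ.PathArrow × B | q.1 ∈ Λ.Z {p | (p, q.2) ∈ K} m} := by
  rw [← isOpen_compl_iff, isOpen_iff_mem_nhds]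
  rintro ⟨t, a⟩ hta
  set D := {p ∈ Prod.fst '' K | ∃ x, t.1.1.IsConcat p.1 x ∧ t.1.2.2.IsConcat p.2 x ∧
    t.1.2.1 = Λ.degDiff p.1 p.2 ∧ Λ.degDiff p.1 p.2 = m} with hD
  have hDfin : D.Finite := (finite_decompositions (hK.image continuous_fst) t).subset
    fun p ⟨hp, x, h1, h2, _⟩ => ⟨hp, x, h1, h2⟩
  -- Each of the finitely many dangerous pairs avoids the closed set `K` over a neighbourhood of
  -- `a`; finiteness allows one neighbourhood for all of them.
  have hev : ∀ᶠ b in 𝓝 a, ∀ p ∈ D, (p, b) ∉ K := by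
    refine (Filter.eventually_all_finite hDfin).2 fun p hp => ?_
    obtain ⟨-, x, hx⟩ := hp
    have hpa : (p, a) ∈ Kᶜ := fun h => hta ⟨p.1, p.2, x, h, hx⟩
    exact (Continuous.prodMk_right p).continuousAt.eventually
      (hK.isClosed.isOpen_compl.mem_nhds hpa)
  obtain ⟨N, hNa, hNsub, hN⟩ := local_compact_nhds hev
  have hKN : IsCompact (Prod.fst '' (K ∩ Prod.snd ⁻¹' N)) :=
    (hK.inter_right (hN.isClosed.preimage continuous_snd)).image continuous_fst
  have hcl := isClosed_Z hKN ((Set.image_mono Set.inter_subset_left).trans hKs) m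
  have ht : t ∉ Λ.Z (Prod.fst '' (K ∩ Prod.snd ⁻¹' N)) m := by
    rintro ⟨f, g, x, ⟨⟨p, b⟩, ⟨hpK, hb⟩, hp⟩, hx⟩
    obtain rfl : p = (f, g) := hp
    exact hNsub hb _ ⟨⟨_, hpK, rfl⟩, x, hx⟩ hpK
  refine Filter.mem_of_superset (prod_mem_nhds (hcl.isOpen_compl.mem_nhds ht) hNa) ?_
  rintro ⟨t', b⟩ ⟨ht', hb⟩ ⟨f, g, x, hfg, hx⟩
  exact ht' ⟨f, g, x, ⟨_, ⟨hfg, hb⟩, rfl⟩, hx⟩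

theorem continuous_liftArrow :
    Continuous fun q : Λ.PathArrow × A => liftArrow c q.1 q.2 := by
  refine continuous_generateFrom_iff.2 ?_
  rintro _ ⟨m, U, V, F, hU, hV, hF, hFs, rfl⟩
  refine IsOpen.inter ?_ (isOpen_compl_iff.2 ?_)
  · refine (congrArg IsOpen (Set.ext fun ⟨t, a⟩ => ?_)).mpr
      (isOpen_setOf_mem_Z ((hU.prod hV).preimage (continuous_liftPair (c := c))) m)
    refine liftArrow_mem_Z.trans ⟨?_, ?_⟩
    · rintro ⟨f, g, x, ⟨hf, hg, -⟩, h⟩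
      exact ⟨f, g, x, ⟨hf, hg⟩, h⟩
    · rintro ⟨f, g, x, ⟨hf, hg⟩, h⟩
      exact ⟨f, g, x, ⟨hf, hg, liftPair_source (src_eq h.1 h.2.1) a⟩, h⟩
  -- `κ` forgets the second group coordinate, which is recoverable since pairs in `F` have a common
  -- source; thus the compact set `κ '' F` has the slices required by `liftArrow_mem_Z`.
  · let κ : (Λ.skew c).Mor × (Λ.skew c).Mor → (Λ.Mor × Λ.Mor) × A :=
      fun p => ((p.1.1, p.2.1), p.1.2)
    have hκ : Continuous κ := by
      change Continuous fun p : (Λ.Mor × A) × (Λ.Mor × A) => ((p.1.1, p.2.1), p.1.2)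
      fun_prop
    have hκs : Prod.fst '' (κ '' F) ⊆ Λ.starS Set.univ Set.univ := by
      rintro _ ⟨_, ⟨p, hp, rfl⟩, rfl⟩
      exact ⟨trivial, trivial, congrArg Prod.fst (hFs hp).2.2⟩
    refine (congrArg IsClosed (Set.ext fun ⟨t, a⟩ => ?_)).mpr
      (isClosed_setOf_mem_Z (hF.image hκ) hκs m)
    have e : {p | liftPair c (p, a) ∈ F} = {p | (p, a) ∈ κ '' F} := by
      ext p
      refine ⟨fun h => ⟨_, h, rfl⟩, ?_⟩
      rintro ⟨⟨f, g⟩, hfg, hp⟩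
      obtain ⟨rfl, rfl⟩ := Prod.mk.inj hp
      change liftPair c ((f.1, g.1), f.2) ∈ F
      rwa [liftPair_of_source (hFs hfg).2.2]
    exact liftArrow_mem_Z.trans (by rw [e]; rfl)

/-- The coordinate of the range is that of the first factor in any decomposition, so it is
controlled by an open condition on that factor. -/
theorem continuous_range_snd :
    Continuous fun t : (Λ.skew c).PathArrow => (t.1.1.range.2 : A) := by
  refine continuous_def.2 fun N hN => isOpen_iff_mem_nhds.2 fun t ht => ?_
  obtain ⟨f, g, x, hs, h1, h2, hd⟩ := t.2
  have hU : IsOpen (Prod.snd ⁻¹' N : Set (Λ.Mor × A)) := hN.preimage continuous_snd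
  refine Filter.mem_of_superset ((isOpen_Z (Λ := Λ.skew c) hU isOpen_univ t.1.2.1).mem_nhds
    ⟨f, g, x, ⟨show f.2 ∈ N from h1.range_snd ▸ ht, trivial, hs⟩, h1, h2, hd, hd.symm⟩) ?_
  rintro t' ⟨f', g', x', ⟨hf', -⟩, h1', -⟩
  change t'.1.1.range.2 ∈ N
  rw [h1'.range_snd]
  exact hf'

theorem projArrow_mem_Z {t : (Λ.skew c).PathArrow} {F : Set (Λ.Mor × Λ.Mor)} {m : Fin k → ℤ} :
    projArrow t ∈ Λ.Z F m ↔ t ∈ (Λ.skew c).Z {p | (p.1.1, p.2.1) ∈ F} m := by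
  rw [← liftArrow_projArrow t, liftArrow_mem_Z]
  rfl

theorem continuous_projArrow : Continuous (projArrow (c := c)) := by
  refine continuous_generateFrom_iff.2 ?_
  rintro _ ⟨m, U, V, F, hU, hV, hF, hFs, rfl⟩
  refine IsOpen.inter ?_ (isOpen_iff_mem_nhds.2 fun t ht => ?_)
  · have hU' : IsOpen (Prod.fst ⁻¹' U : Set (Λ.Mor × A)) := hU.preimage continuous_fst
    have hV' : IsOpen (Prod.fst ⁻¹' V : Set (Λ.Mor × A)) := hV.preimage continuous_fst
    refine (congrArg IsOpen (Set.ext fun t => ?_)).mpr (isOpen_Z (Λ := Λ.skew c) hU' hV' m)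
    refine projArrow_mem_Z.trans ⟨?_, ?_⟩
    · rintro ⟨f, g, x, ⟨hf, hg, -⟩, h⟩
      exact ⟨f, g, x, ⟨hf, hg, src_eq h.1 h.2.1⟩, h⟩
    · rintro ⟨f, g, x, ⟨hf, hg, hs⟩, h⟩
      exact ⟨f, g, x, ⟨hf, hg, congrArg Prod.fst hs⟩, h⟩
  -- The pairs over `F` have arbitrary coordinates in `A`. Those with first coordinate in `N` form
  -- the compact set `liftPair c '' (F ×ˢ N)`, and these suffice for arrows whose range has
  -- coordinate in `N`.
  · obtain ⟨N, hN, hNa⟩ := exists_compact_mem_nhds (t.1.1.range.2 : A)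
    have hcl := isClosed_Z (Λ := Λ.skew c) ((hF.prod hN).image (continuous_liftPair (c := c)))
      (by
        rintro _ ⟨⟨⟨f, g⟩, a⟩, ⟨hfg, -⟩, rfl⟩
        exact ⟨trivial, trivial, liftPair_source (hFs hfg).2.2 a⟩) m
    have htc : t ∉ (Λ.skew c).Z (liftPair c '' (F ×ˢ N)) m := by
      rintro ⟨f, g, x, ⟨q, ⟨hq, -⟩, hqe⟩, h⟩
      refine ht (projArrow_mem_Z.2 ⟨f, g, x, ?_, h⟩)
      obtain ⟨rfl, rfl⟩ := Prod.mk.inj hqe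
      exact hq
    filter_upwards [hcl.isOpen_compl.mem_nhds htc, continuous_range_snd.continuousAt hNa]
      with t' h1 h2 h3
    obtain ⟨f, g, x, hfg, h⟩ := projArrow_mem_Z.1 h3
    refine h1 ⟨f, g, x, ⟨((f.1, g.1), f.2), ⟨hfg, ?_⟩, liftPair_of_source (src_eq h.1 h.2.1)⟩, h⟩
    exact h.1.range_snd ▸ h2

/-! ### The isomorphism of path groupoids. -/

variable (c) in
/-- The homeomorphism between the arrows of `G_Λ(c̃)` and those of `G_{Λ ×_c A}`. -/
noncomputable def liftArrowHomeomorph : Λ.PathArrow × A ≃ₜ (Λ.skew c).PathArrow where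
  toEquiv := liftArrowEquiv c
  continuous_toFun := continuous_liftArrow
  continuous_invFun := continuous_projArrow.prodMk continuous_range_snd

variable (c) in
/-- The isomorphism `G_Λ(c̃) ≅ G_{Λ ×_c A}`. -/
noncomputable def skewPathGroupoidIso :
    TopGroupoid.Iso (Λ.pathGroupoid.skew (inducedCocycle c)) (Λ.skew c).pathGroupoid :=
  TopGroupoid.Iso.ofMor (G := Λ.pathGroupoid.skew (inducedCocycle c))
    (H := (Λ.skew c).pathGroupoid) (Path.liftEquiv c) (liftArrowHomeomorph c)
    -- Ranges and sources match by construction; units and products reduce to `c̃` being a functor,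
    -- which is what makes the source coordinates agree.
    (fun _ => rfl) (fun _ => rfl)
    (fun p => Subtype.ext <| Prod.ext rfl <| Prod.ext rfl <| by
      change p.1.lift c (p.2 * (inducedCocycle c).toFun (Λ.pathGroupoid.one p.1)) = p.1.lift c p.2
      rw [(inducedCocycle c).map_one, mul_one])
    (fun p q h => Subtype.ext <| Prod.ext rfl <| Prod.ext rfl <| by
      have h1 := (inducedCocycle c).map_comp p.1 q.1 (congrArg Prod.fst h)
      have h2 : p.2 * (inducedCocycle c).toFun p.1 = q.2 := congrArg Prod.snd h
      change q.1.1.2.2.lift c (p.2 * (inducedCocycle c).toFun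
        (Λ.pathGroupoid.comp p.1 q.1 (congrArg Prod.fst h))) = q.1.1.2.2.lift c
          (q.2 * (inducedCocycle c).toFun q.1)
      rw [h1, ← mul_assoc, h2])

/-! ### Boundary paths of the skew product -/

/-- Composition keeps the coordinate of its left factor, so a common extension forces `a = b`;
conversely the extending morphisms have the forced coordinates `a c(f)` and `a c(g)`. -/
theorem minExt_skew_nonempty_iff {f g : Λ.Mor} {a b : A} :
    ((Λ.skew c).minExt (f, a) (g, b)).Nonempty ↔ a = b ∧ (Λ.minExt f g).Nonempty := by
  constructor
  · rintro ⟨⟨α, β⟩, h, h', he, hd⟩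
    exact ⟨congrArg Prod.snd he, ⟨(α.1, β.1), congrArg Prod.fst h, congrArg Prod.fst h',
      congrArg Prod.fst he, hd⟩⟩
  · rintro ⟨rfl, ⟨α, β⟩, h, h', he, hd⟩
    exact ⟨((α, a * c.toFun f), (β, a * c.toFun g)), Prod.ext h rfl, Prod.ext h' rfl,
      Prod.ext he rfl, hd⟩

variable (c) in
theorem prod_mem_CE {v : Λ.Obj} {a : A} {E : Set Λ.Mor} (hE : E ∈ Λ.CE v) {N : Set A}
    (hN : IsCompact N) (hNa : N ∈ 𝓝 a) : (E ×ˢ N : Set (Λ.Mor × A)) ∈ (Λ.skew c).CE (v, a) := by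
  obtain ⟨hc, hn, he⟩ := hE
  refine ⟨hc.prod hN, ?_, fun g hg => ⟨g, hg, rfl⟩, ?_⟩
  · refine Filter.mem_of_superset (prod_mem_nhds hn hNa) ?_
    rintro ⟨_, b⟩ ⟨⟨g, hg, rfl⟩, hb⟩
    exact ⟨(g, b), ⟨hg, hb⟩, rfl⟩
  · rintro ⟨f, b⟩ ⟨⟨g, b'⟩, ⟨hg, hb⟩, hr⟩
    obtain rfl : b' = b := congrArg Prod.snd hr
    obtain ⟨g', hg', hne⟩ := he.2 f ⟨g, hg, congrArg Prod.fst hr⟩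
    exact ⟨(g', b'), ⟨hg', hb⟩, minExt_skew_nonempty_iff.2 ⟨rfl, hne⟩⟩

/-- Slicing by the coordinate of a morphism is slicing by the coordinate of its range, so the slice
keeps exactly the part of `E` that meets morphisms of coordinate `a`. -/
theorem slice_mem_CE {v : Λ.Obj} {a : A} {E : Set (Λ.skew c).Mor}
    (hE : E ∈ (Λ.skew c).CE (v, a)) : {f : Λ.Mor | ((f, a) : Λ.Mor × A) ∈ E} ∈ Λ.CE v := by
  obtain ⟨hc, hn, he⟩ := hE
  refine ⟨?_, ?_, fun g hg => ⟨g, hg, rfl⟩, ?_⟩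
  · have hcl : IsClosed E := hc.isClosed
    have himg : IsCompact (Prod.fst '' (E ∩ Prod.snd ⁻¹' {a}) : Set Λ.Mor) :=
      (IsCompact.inter_right (X := Λ.Mor × A) hc
        (isClosed_singleton.preimage continuous_snd)).image continuous_fst
    convert himg using 1
    ext f
    refine ⟨fun h => ⟨(f, a), ⟨h, rfl⟩, rfl⟩, ?_⟩
    rintro ⟨⟨f', a'⟩, ⟨h, rfl⟩, rfl⟩
    exact h
  · refine Filter.mem_of_superset ((Continuous.prodMk_left a).continuousAt hn) ?_
    rintro v' ⟨g, hg, hr⟩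
    obtain rfl : g.2 = a := congrArg Prod.snd hr
    exact ⟨g.1, hg, congrArg Prod.fst hr⟩
  · rintro f ⟨g, hg, hr⟩
    obtain ⟨g', hg', hne⟩ := he.2 (f, a) ⟨(g, a), hg, Prod.ext hr rfl⟩
    obtain ⟨rfl, hne'⟩ := minExt_skew_nonempty_iff.1 hne
    exact ⟨g'.1, hg', hne'⟩

theorem isBoundary_lift_iff {x : Λ.Path} {a : A} :
    (x.lift c a).IsBoundary ↔ x.IsBoundary := by
  constructor
  · intro h m hm E hE
    -- The group element is the coordinate of the lifted path at `m`; any compact neighbourhood of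
    -- it thickens `E` to a set usable upstairs.
    obtain ⟨N, hN, hNa⟩ := exists_compact_mem_nhds (a * c.toFun (x.map 0 m zero_le hm))
    obtain ⟨f, hf, hd, he⟩ := h m hm _ (prod_mem_CE c hE hN hNa)
    exact ⟨f.1, hf.1, hd, congrArg Prod.fst he⟩
  · intro h m hm E hE
    obtain ⟨f, hf, hd, he⟩ := h m hm _ (slice_mem_CE hE)
    exact ⟨_, hf, hd, Prod.ext he rfl⟩

end TopKGraph

end HRGraph

theorem mainTheorem6 {k : ℕ} (Λ : HRGraph.TopKGraph.{u, v} k)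
    [SecondCountableTopology Λ.Obj] [SecondCountableTopology Λ.Mor]
    (hΛ : Λ.CompactlyAligned)
    {A : Type w} [Group A] [TopologicalSpace A] [IsTopologicalGroup A]
    [LocallyCompactSpace A] [T2Space A]
    (c : HRGraph.ContFunctor Λ.toArrCat A) :
    Nonempty (HRGraph.TopGroupoid.Iso
      (Λ.pathGroupoid.skew (HRGraph.TopKGraph.inducedCocycle c))
      (Λ.skew c).pathGroupoid) ∧
    Nonempty (HRGraph.TopGroupoid.Iso
      (Λ.boundaryGroupoid.skew
        (HRGraph.TopGroupoid.restrict (HRGraph.TopKGraph.inducedCocycle c) Λ.boundary))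
      (Λ.skew c).boundaryGroupoid) :=
  ⟨⟨HRGraph.TopKGraph.skewPathGroupoidIso c⟩,
    ⟨(HRGraph.TopKGraph.skewPathGroupoidIso c).restrictSkew Λ.boundary (Λ.skew c).boundary
      fun _ _ => HRGraph.TopKGraph.isBoundary_lift_iff⟩⟩
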